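/- Let $k$ be a field, $K$ an algebraically closed extension field of $k$ and $\mathbb P^N$ projective space with homogeneous coordinates $x_0,\dots,x_N$. A \emph{scalar permutation} is an automorphism of $\mathbb P^N_K$, i.e. an element of $\mathrm{PGL}_{N+1}(K)$, whose matrix has exactly one non-zero entry in each row and in each column. For a projective algebraic set $X\subset\mathbb P^N(K)$ defined over $k$, the \emph{linear automorphism group} of $X$ is the group of all automorphisms of $\mathbb P^N_K$ mapping $X$ onto itself. A \emph{diagonal form} of degree $d$ is a polynomial $\sum_{j=0}^N a_jx_j^d$. (1) Let $X\subset\mathbb P^N$ be a projective variety defined over $k$ (not necessarily irreducible), smooth over $k$, not contained in a hyperplane and of codimension $c\ge 2$, whose defining ideal in $k[x_0,\dots,x_N]$ is a complete intersection of diagonal hypersurfaces of the same degree $d\ge 2$, that is, it is generated by $c$ diagonal forms of degree $d$. Then the linear automorphism group of $X$ consists of scalar permutations. (2) Let $n\ge 4$ and let $X_n\subset\mathbb P^n$ be the Büchi surface over $k$, that is, the scheme defined by the equations $x_{i+2}^2-2x_{i+1}^2+x_i^2-2x_0^2=0$ for $i\in\{1,\dots,n-2\}$. If $X_n$ is smooth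 over $k$, then the linear automorphism group of $X_n$ consists of scalar permutations. -/

import Mathlib

open scoped LinearAlgebra.Projectivization Pointwise

noncomputable section

namespace ProjVar

/-- Projective `N`-space over a field: its points are the lines of `K ^ (N + 1)`, with
homogeneous coordinates `x 0, …, x N`. -/
abbrev PSpace (K : Type*) [Field K] (N : ℕ) : Type _ := ℙ K (Fin (N + 1) → K)

/-- The affine cone without its vertex: all vectors of homogeneous coordinates of points
of `X`. -/
def coneOf {K : Type*} [Field K] {N : ℕ} (X : Set (PSpace K N)) : Set (Fin (N + 1) → K) :=
  {v | ∃ hv : v ≠ 0, Projectivization.mk K v hv ∈ X}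

/-- The defining ideal of `X` in `k[x 0, …, x N]`: the polynomials over `k` that vanish at all
homogeneous coordinates of all points of `X`. (The field `K` is infinite in all uses, and then
this ideal is generated by the homogeneous polynomials that vanish on `X`.) -/
def definingIdeal (k : Type*) {K : Type*} [Field k] [Field K] [Algebra k K] {N : ℕ}
    (X : Set (PSpace K N)) : Ideal (MvPolynomial (Fin (N + 1)) k) :=
  MvPolynomial.vanishingIdeal k (coneOf X)

/-- The set of points of `ℙ^N(K)` at which all elements of a (homogeneous) ideal vanish. -/
def zeroSet {k : Type*} (K : Type*) [Field k] [Field K] [Algebra k K] {N : ℕ}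
    (I : Ideal (MvPolynomial (Fin (N + 1)) k)) : Set (PSpace K N) :=
  {p | ∀ (v : Fin (N + 1) → K) (hv : v ≠ 0), Projectivization.mk K v hv = p →
    v ∈ MvPolynomial.zeroLocus K I}

/-- `X` is a projective algebraic set defined over `k`. -/
def IsProjectiveOver (k : Type*) {K : Type*} [Field k] [Field K] [Algebra k K] {N : ℕ}
    (X : Set (PSpace K N)) : Prop :=
  zeroSet K (definingIdeal k X) = X

/-- The codimension of `X` in `ℙ^N`: the height of its defining ideal. (It is `⊤` for `X = ∅`.) -/
def codim (k : Type*) {K : Type*} [Field k] [Field K] [Algebra k K] {N : ℕ}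
    (X : Set (PSpace K N)) : ℕ∞ :=
  (definingIdeal k X).height

/-- `X` is not contained in a hyperplane. -/
def IsNondegenerate (k : Type*) {K : Type*} [Field k] [Field K] [Algebra k K] {N : ℕ}
    (X : Set (PSpace K N)) : Prop :=
  ∀ f ∈ definingIdeal k X, f.IsHomogeneous 1 → f = 0

/-- The gradient `(∂f/∂x 0, …, ∂f/∂x N)` evaluated at `v`. -/
def gradAt {k K : Type*} [Field k] [Field K] [Algebra k K] {N : ℕ}
    (f : MvPolynomial (Fin (N + 1)) k) (v : Fin (N + 1) → K) : Fin (N + 1) → K :=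
  fun j => MvPolynomial.aeval v (MvPolynomial.pderiv j f)

/-- Smoothness over `k` of the projective scheme in `ℙ^N` defined by a homogeneous ideal `I`
all of whose components have the same codimension (such as a complete intersection), by the
Jacobian criterion: at every point with coordinates in the algebraically closed field `K`, the
Jacobian matrix has rank equal to the codimension of the scheme. The rank is the dimension of the
span of the gradients of all elements of `I`, which is the same as that of the gradients of
generators of `I`. -/
def IsSmooth {k : Type*} (K : Type*) [Field k] [Field K] [Algebra k K] {N : ℕ}
    (I : Ideal (MvPolynomial (Fin (N + 1)) k)) : Prop :=
  ∀ v : Fin (N + 1) → K, v ≠ 0 → v ∈ MvPolynomial.zeroLocus K I →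
    (Module.finrank K (Submodule.span K {w | ∃ f ∈ I, w = gradAt f v}) : ℕ∞) = I.height

/-- A diagonal form of degree `d`: `a 0 * (x 0)^d + ⋯ + a N * (x N)^d`. -/
def IsDiagonalForm {k : Type*} [Field k] {N : ℕ} (d : ℕ)
    (f : MvPolynomial (Fin (N + 1)) k) : Prop :=
  ∃ a : Fin (N + 1) → k, f = ∑ j, MvPolynomial.C (a j) * MvPolynomial.X j ^ d

/-- `I` is a complete intersection of diagonal forms of degree `d`: it is generated by as many such
forms as its height. -/
def IsDiagonalCompleteIntersection {k : Type*} [Field k] {N : ℕ} (d : ℕ)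
    (I : Ideal (MvPolynomial (Fin (N + 1)) k)) : Prop :=
  ∃ (c : ℕ) (f : Fin c → MvPolynomial (Fin (N + 1)) k),
    (∀ i, IsDiagonalForm d (f i)) ∧ I = Ideal.span (Set.range f) ∧ I.height = c

/-- The linear automorphism group of `X`: the automorphisms of `ℙ^N`, that is, the
elements of `PGL(N + 1, K)`, that map `X` onto itself. -/
def linearAut {K : Type*} [Field K] {N : ℕ} (X : Set (PSpace K N)) :
    Subgroup (Matrix.ProjGenLinGroup (Fin (N + 1)) K) :=
  MulAction.stabilizer (Matrix.ProjGenLinGroup (Fin (N + 1)) K) X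

/-- A scalar permutation: an automorphism of `ℙ^N` given by a matrix with exactly one non-zero entry
in each row and in each column. -/
def IsScalarPermutation {K : Type*} [Field K] {N : ℕ}
    (φ : Matrix.ProjGenLinGroup (Fin (N + 1)) K) : Prop :=
  ∃ g : Matrix.GeneralLinearGroup (Fin (N + 1)) K, Matrix.ProjGenLinGroup.mk g = φ ∧
    (∀ i, ∃! j, g.val i j ≠ 0) ∧ (∀ j, ∃! i, g.val i j ≠ 0)

/-- The ideal of the equations `x (i+2)^2 - 2 x (i+1)^2 + x i^2 - 2 x 0^2 = 0`, for
`1 ≤ i ≤ n - 2`, of the Büchi surface in `ℙ^n`. -/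
def buchiIdeal (k : Type*) [Field k] (n : ℕ) : Ideal (MvPolynomial (Fin (n + 1)) k) :=
  Ideal.span {f | ∃ (i : ℕ) (_ : 1 ≤ i) (hi : i + 2 ≤ n),
    f = MvPolynomial.X ⟨i + 2, by omega⟩ ^ 2 - 2 * MvPolynomial.X ⟨i + 1, by omega⟩ ^ 2
      + MvPolynomial.X ⟨i, by omega⟩ ^ 2 - 2 * MvPolynomial.X 0 ^ 2}

/-- The Büchi surface, as the set of its points over `K`. -/
def buchiSurface (k K : Type*) [Field k] [Field K] [Algebra k K] (n : ℕ) : Set (PSpace K n) :=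
  zeroSet K (buchiIdeal k n)

end ProjVar

end

/-!
Let `X` be an intersection of diagonal hypersurfaces of degree `d ≥ 2` in `ℙ^N`, let `C` be its
affine cone, and let `D` be the space of coefficient vectors of the diagonal forms over `K` that
vanish on `C`. Both parts follow from three facts about `C` and `D`.

* `d` is invertible in `K` (`natCast_ne_zero_of_isSmooth`): otherwise all gradients vanish on `C`,
  while smoothness makes the Jacobian rank equal to the codimension, which is at least `2`.
* For `i ≠ j` some `a ∈ D` has `a i ≠ 0` and `a j = 0` (`exists_relation_separating`): otherwise
  the `i`-th and `j`-th coordinates are proportional on `D`, so `C` has a point supported on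
  `{i, j}`, at which the Jacobian matrix has rank at most `1`.
* `C` has a point `v` without zero coordinates. The vectors of `d`-th powers of coordinates of
  points of `C` form a linear space, the orthogonal complement of `D`, so by `exists_forall_ne_zero`
  it suffices to have, for each `j`, a point of `C` with nonzero `j`-th coordinate. In the first
  part this is nondegeneracy; on the Büchi surface, arithmetic progressions give such points.

Let `g` be an invertible matrix mapping `C` to itself. For `a ∈ D`, the form
`F = ∑ i, a i * (g x)_i ^ d` vanishes on `C`, hence at all `w` with `w j ^ d = v j ^ d` for all `j`.
These `w` form a grid with `d` values in each direction. A non-diagonal monomial of degree `d` has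
all exponents less than `d`, so by the combinatorial Nullstellensatz it does not occur in `F`:
`F = ∑ j, b j * x_j ^ d` is diagonal (`exists_sum_mul_pow_eq`). The gradient of a diagonal form
vanishes exactly on a coordinate subspace, so `g` maps the coordinate subspace belonging to `b` onto
the one belonging to `a`. By the second fact each coordinate hyperplane `x_i = 0` is the sum of the
subspaces belonging to the `a ∈ D` with `a i ≠ 0`; therefore `g` permutes the coordinate hyperplanes
(`monomial_of_cone_stable`). The ideal of `X` over `K` is never needed.
-/

namespace ProjVar

/-! ### Forms restricted to a fibre of the power map -/

section Diagonal

variable {ι K : Type*} [Field K]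

theorem card_nthRoots_of_ne_zero [DecidableEq K] [IsAlgClosed K] {d : ℕ} (hd : (d : K) ≠ 0)
    {a : K} (ha : a ≠ 0) :
    (Polynomial.nthRoots d a).toFinset.card = d := by
  have hsep := Polynomial.separable_X_pow_sub_C a hd ha
  have hnodup : (Polynomial.nthRoots d a).Nodup := Polynomial.nodup_roots hsep
  rw [Multiset.toFinset_card_of_nodup hnodup, Polynomial.nthRoots,
    ← (IsAlgClosed.splits _).natDegree_eq_card_roots, Polynomial.natDegree_X_pow_sub_C]

/-- A form of degree `d` that vanishes at all `w` with `w j ^ d = v j ^ d` contains only the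
monomials `x_j ^ d`: every other monomial of degree `d` has all exponents less than `d`, the number
of values of each `w j`, and the combinatorial Nullstellensatz applies. -/
theorem eq_single_of_coeff_ne_zero [Finite ι] [IsAlgClosed K] {d : ℕ} (hd : (d : K) ≠ 0)
    {G : MvPolynomial ι K} (hG : G.IsHomogeneous d) {v : ι → K} (hv : ∀ j, v j ≠ 0)
    (hvan : ∀ w : ι → K, (∀ j, w j ^ d = v j ^ d) → MvPolynomial.eval w G = 0)
    {m : ι →₀ ℕ} (hm : G.coeff m ≠ 0) : ∃ j, m = Finsupp.single j d := by
  classical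
  have hd0 : 0 < d := Nat.pos_of_ne_zero (by rintro rfl; simp at hd)
  have hdeg : m.degree = d := by
    rw [← hG hm, Finsupp.degree_eq_weight_one]
    rfl
  by_contra! hne
  have hlt : ∀ j, m j < d := by
    intro j
    refine lt_of_le_of_ne (hdeg ▸ Finsupp.le_degree j m) fun hj => hne j ?_
    -- An exponent equal to `d` uses up the whole degree, so all others vanish.
    have hle : Finsupp.single j d ≤ m := by simp [hj]
    have hadd : (m - Finsupp.single j d) + Finsupp.single j d = m := tsub_add_cancel_of_le hle
    have h0 : (m - Finsupp.single j d).degree = 0 := by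
      have := congrArg Finsupp.degree hadd
      rw [map_add, hdeg, Finsupp.degree_single] at this
      omega
    rw [Finsupp.degree_eq_zero_iff] at h0
    rw [← hadd, h0, zero_add]
  obtain ⟨w, hw, hne0⟩ := MvPolynomial.combinatorial_nullstellensatz_exists_eval_nonzero G m hm
    ((hG.totalDegree (by rintro rfl; simp at hm)).trans hdeg.symm)
    (fun j => (Polynomial.nthRoots d (v j ^ d)).toFinset)
    (fun j => by rw [card_nthRoots_of_ne_zero hd (pow_ne_zero d (hv j))]; exact hlt j)
  refine hne0 (hvan w fun j => ?_)
  simpa [Polynomial.mem_nthRoots hd0] using hw j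

theorem eq_sum_C_mul_X_pow [Fintype ι] [DecidableEq ι] {d : ℕ} (hd : d ≠ 0) {G : MvPolynomial ι K}
    (hG : ∀ m, G.coeff m ≠ 0 → ∃ j, m = Finsupp.single j d) :
    G = ∑ j, MvPolynomial.C (G.coeff (Finsupp.single j d)) * MvPolynomial.X j ^ d := by
  ext m
  simp only [MvPolynomial.coeff_sum, MvPolynomial.coeff_C_mul, MvPolynomial.coeff_X_pow]
  by_cases hm : G.coeff m = 0
  · rw [hm, eq_comm]
    refine Finset.sum_eq_zero fun j _ => ?_
    split_ifs with h
    · rw [h, hm, zero_mul]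
    · rw [mul_zero]
  · obtain ⟨j, rfl⟩ := hG m hm
    rw [Finset.sum_eq_single j]
    · simp
    · intro i _ hij
      rw [if_neg (fun h => hij (Finsupp.single_left_injective hd h)), mul_zero]
    · simp

/-- Over an infinite field, a subspace that lies in no coordinate hyperplane contains a vector
without zero coordinates, since it is not the union of its intersections with these hyperplanes. -/
theorem exists_forall_ne_zero [Finite ι] [Infinite K] {V : Submodule K (ι → K)}
    (h : ∀ j, ∃ y ∈ V, y j ≠ 0) : ∃ y ∈ V, ∀ j, y j ≠ 0 := by
  by_contra! hcon
  obtain ⟨j, hj⟩ := Subspace.exists_eq_top_of_iUnion_eq_univ (k := K) (E := V)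
    (p := fun j => LinearMap.ker ((LinearMap.proj j : (ι → K) →ₗ[K] K) ∘ₗ V.subtype))
    (Set.eq_univ_of_forall fun y => by
      obtain ⟨j, hj⟩ := hcon y y.2
      exact Set.mem_iUnion.2 ⟨j, by simpa using hj⟩)
  obtain ⟨y, hy, hyj⟩ := h j
  have : (⟨y, hy⟩ : V) ∈ LinearMap.ker ((LinearMap.proj j : (ι → K) →ₗ[K] K) ∘ₗ V.subtype) :=
    hj ▸ Submodule.mem_top
  exact hyj (by simpa using this)

/-- If `∑ i, a i * (g w)_i ^ d` vanishes for all `w` with `w j ^ d = v j ^ d`, where no `v j` is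
zero, then as a polynomial in `w` it is again a diagonal form. -/
theorem exists_sum_mul_pow_eq [Fintype ι] [DecidableEq ι] [IsAlgClosed K] {d : ℕ} (hd : (d : K) ≠ 0)
    {v : ι → K} (hv : ∀ j, v j ≠ 0) (g : Matrix ι ι K) (a : ι → K)
    (hvan : ∀ w : ι → K, (∀ j, w j ^ d = v j ^ d) → ∑ i, a i * (g.mulVec w i) ^ d = 0) :
    ∃ b : ι → K, (∑ i, MvPolynomial.C (a i) * (∑ j, MvPolynomial.C (g i j) * MvPolynomial.X j) ^ d
      : MvPolynomial ι K) = ∑ j, MvPolynomial.C (b j) * MvPolynomial.X j ^ d := by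
  have hd0 : d ≠ 0 := by rintro rfl; simp at hd
  refine ⟨_, eq_sum_C_mul_X_pow hd0 fun m hm => eq_single_of_coeff_ne_zero hd ?_ hv ?_ hm⟩
  · refine MvPolynomial.IsHomogeneous.sum _ _ _ fun i _ => ?_
    have h1 : (∑ j, MvPolynomial.C (g i j) * MvPolynomial.X j : MvPolynomial ι K).IsHomogeneous 1 :=
      MvPolynomial.IsHomogeneous.sum _ _ _ fun j _ => by
        simpa using (MvPolynomial.isHomogeneous_C ι (g i j)).mul (MvPolynomial.isHomogeneous_X K j)
    simpa using (MvPolynomial.isHomogeneous_C ι (a i)).mul (h1.pow d)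
  · intro w hw
    simpa [Matrix.mulVec, dotProduct] using hvan w hw

/-- The partial derivatives by `x_p` of the two sides of
`∑ i, a i * (g x)_i ^ d = ∑ j, b j * x_j ^ d` agree; the common factor `d` is cancelled. -/
theorem sum_mul_pow_mul_eq [Fintype ι] [DecidableEq ι] {d : ℕ} (hd : (d : K) ≠ 0)
    {g : Matrix ι ι K} {a b : ι → K}
    (h : (∑ i, MvPolynomial.C (a i) * (∑ j, MvPolynomial.C (g i j) * MvPolynomial.X j) ^ d
      : MvPolynomial ι K) = ∑ j, MvPolynomial.C (b j) * MvPolynomial.X j ^ d) (u : ι → K) (p : ι) :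
    ∑ i, a i * (g.mulVec u i) ^ (d - 1) * g i p = b p * u p ^ (d - 1) := by
  have hlin : ∀ i, MvPolynomial.pderiv p (∑ j, MvPolynomial.C (g i j) * MvPolynomial.X j :
      MvPolynomial ι K) = MvPolynomial.C (g i p) := fun i => by
    simp [MvPolynomial.pderiv_X, Pi.single_apply]
  have hX : ∀ j, MvPolynomial.pderiv p (MvPolynomial.X j : MvPolynomial ι K) =
      if j = p then 1 else 0 := fun j => by simp [MvPolynomial.pderiv_X, Pi.single_apply]
  have h2 := congrArg (fun f => MvPolynomial.eval u (MvPolynomial.pderiv p f)) h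
  simp only [map_sum, MvPolynomial.pderiv_C_mul, MvPolynomial.pderiv_pow, hlin, hX] at h2
  have heval : ∀ i, ∑ j, g i j * u j = g.mulVec u i := fun i => rfl
  simp [heval, apply_ite] at h2
  refine mul_left_cancel₀ hd ?_
  rw [Finset.mul_sum]
  rw [mul_left_comm, ← h2]
  exact Finset.sum_congr rfl fun i _ => by ring

/-- An invertible matrix that maps the cone `C` into itself is monomial, if `C` is cut out by the
diagonal forms with coefficients in `D`, any two coordinates are separated by an element of `D`, and
`C` has a point without zero coordinates. -/
theorem monomial_of_cone_stable [Fintype ι] [DecidableEq ι] [IsAlgClosed K] {d : ℕ} (hd2 : 2 ≤ d)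
    (hd : (d : K) ≠ 0) {D : Set (ι → K)} {C : Set (ι → K)}
    (hC : ∀ v, v ∈ C ↔ ∀ a ∈ D, ∑ j, a j * v j ^ d = 0)
    (hD : ∀ i j, i ≠ j → ∃ a ∈ D, a i ≠ 0 ∧ a j = 0)
    (hne : ∃ v ∈ C, ∀ j, v j ≠ 0)
    {g : GL ι K} (hg : ∀ v ∈ C, g.val.mulVec v ∈ C) :
    (∀ i, ∃! j, g.val i j ≠ 0) ∧ (∀ j, ∃! i, g.val i j ≠ 0) := by
  obtain ⟨v, hvC, hv⟩ := hne
  set h := g⁻¹.val with hh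
  have hgh : g.val * h = 1 := by rw [hh, ← Units.val_mul, mul_inv_cancel, Units.val_one]
  have hhg : h * g.val = 1 := by rw [hh, ← Units.val_mul, inv_mul_cancel, Units.val_one]
  -- The `i`-th row of `g` is a linear form, with kernel `g⁻¹ H_i` for the coordinate hyperplane
  -- `H_i`. If its `p`-th entry is nonzero, then `g⁻¹ H_i ⊆ H_p`. To see that `g⁻¹ e_j ∈ H_p`, take
  -- `a ∈ D` with `a i ≠ 0` and `a j = 0`, and pull back the form with coefficients `a` to the one
  -- with coefficients `b`. The gradient of the former vanishes at `e_j`, so that of the latter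
  -- vanishes at `g⁻¹ e_j`, and it remains to see that `b p ≠ 0`.
  have key : ∀ i p j, g.val i p ≠ 0 → j ≠ i → h p j = 0 := by
    intro i p j hip hji
    obtain ⟨a, haD, hai, haj⟩ := hD i j hji.symm
    obtain ⟨b, hb⟩ := exists_sum_mul_pow_eq hd hv g.val a fun w hw =>
      (hC _).1 (hg w ((hC w).2 fun a ha => by simpa only [hw] using (hC v).1 hvC a ha)) a haD
    have hd1 : d - 1 ≠ 0 := by omega
    have hgrad := sum_mul_pow_mul_eq hd hb
    have hbp : b p ≠ 0 := by
      -- If `b p = 0`, the gradient at `e_p` vanishes, and so does that of the form with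
      -- coefficients `a`, at `g e_p`; but the `i`-th coordinate of `g e_p` is nonzero, as is `a i`.
      intro hbp
      have h0 : ∀ l, ∑ i, a i * (g.val.mulVec (Pi.single p 1) i) ^ (d - 1) * g.val i l = 0 := by
        intro l
        rw [hgrad]
        rcases eq_or_ne l p with rfl | hl
        · rw [hbp, zero_mul]
        · simp [hl, hd1]
      have h1 : Matrix.vecMul (fun i => a i * g.val i p ^ (d - 1)) g.val = 0 := by
        ext l
        simpa [Matrix.vecMul, dotProduct] using h0 l
      have h2 : (fun i => a i * g.val i p ^ (d - 1)) = 0 := by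
        rw [← Matrix.vecMul_one (fun i => a i * g.val i p ^ (d - 1)), ← hgh,
          ← Matrix.vecMul_vecMul, h1, Matrix.zero_vecMul]
      exact mul_ne_zero hai (pow_ne_zero _ hip) (congrFun h2 i)
    have hu := hgrad (fun q => h q j) p
    have hmul : g.val.mulVec (fun q => h q j) = Pi.single j 1 := by
      ext i
      change (g.val * h) i j = _
      rw [hgh, Matrix.one_apply, Pi.single_apply]
    rw [hmul, Finset.sum_eq_zero, eq_comm, mul_eq_zero] at hu
    · exact pow_eq_zero_iff hd1 |>.1 (hu.resolve_left hbp)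
    · intro l _
      rcases eq_or_ne l j with rfl | hl
      · rw [haj, zero_mul, zero_mul]
      · simp [hl, hd1]
  have key2 : ∀ i p, g.val i p ≠ 0 → ∀ q, h p i * g.val i q = (1 : Matrix ι ι K) p q := by
    intro i p hip q
    rw [← hhg, Matrix.mul_apply, Finset.sum_eq_single i]
    · exact fun j _ hj => by rw [key i p j hip hj, zero_mul]
    · simp
  have hinv : ∀ i p, g.val i p ≠ 0 → h p i ≠ 0 := fun i p hip h0 => by
    simpa [h0] using key2 i p hip p
  constructor
  · intro i
    have : ∃ p, g.val i p ≠ 0 := by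
      by_contra! h0
      simpa [Matrix.mul_apply, h0] using congrFun (congrFun hgh i) i
    obtain ⟨p, hip⟩ := this
    refine ⟨p, hip, fun q hiq => ?_⟩
    by_contra hqp
    have := key2 i p hip q
    rw [Matrix.one_apply_ne (Ne.symm hqp)] at this
    exact mul_ne_zero (hinv i p hip) hiq this
  · intro p
    have : ∃ i, g.val i p ≠ 0 := by
      by_contra! h0
      simpa [Matrix.mul_apply, h0] using congrFun (congrFun hhg p) p
    obtain ⟨i, hip⟩ := this
    refine ⟨i, hip, fun l hlp => ?_⟩
    by_contra hli
    exact hinv l p hlp (key i p l hip hli)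

end Diagonal

/-! ### Smooth intersections of diagonal hypersurfaces -/

section Jacobian

variable {k K : Type*} [Field k] [Field K] [Algebra k K] {N : ℕ}

theorem aeval_diagonal (d : ℕ) (a : Fin (N + 1) → k) (v : Fin (N + 1) → K) :
    MvPolynomial.aeval v (∑ j, MvPolynomial.C (a j) * MvPolynomial.X j ^ d) =
      ∑ j, algebraMap k K (a j) * v j ^ d := by
  simp

theorem gradAt_diagonal (d : ℕ) (a : Fin (N + 1) → k) (v : Fin (N + 1) → K) :
    gradAt (∑ j, MvPolynomial.C (a j) * MvPolynomial.X j ^ d) v =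
      fun j => algebraMap k K (a j) * (d * v j ^ (d - 1)) := by
  ext p
  have hX : ∀ j, MvPolynomial.pderiv p (MvPolynomial.X j : MvPolynomial (Fin (N + 1)) k) =
      if j = p then 1 else 0 := fun j => by simp [MvPolynomial.pderiv_X, Pi.single_apply]
  simp [gradAt, hX, apply_ite]

/-- At a zero of an ideal, the gradients of all its elements lie in every subspace that contains the
gradients of generators, by the product rule. -/
theorem gradAt_mem_of_mem_span {S : Set (MvPolynomial (Fin (N + 1)) k)} {v : Fin (N + 1) → K}
    (hv : v ∈ MvPolynomial.zeroLocus K (Ideal.span S)) {M : Submodule K (Fin (N + 1) → K)}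
    (hM : ∀ f ∈ S, gradAt f v ∈ M) {f : MvPolynomial (Fin (N + 1)) k} (hf : f ∈ Ideal.span S) :
    gradAt f v ∈ M := by
  induction hf using Submodule.span_induction with
  | mem f hf => exact hM f hf
  | zero =>
    have : gradAt (0 : MvPolynomial (Fin (N + 1)) k) v = 0 := by ext; simp [gradAt]
    rw [this]; exact M.zero_mem
  | add f g _ _ hf hg =>
    have : gradAt (f + g) v = gradAt f v + gradAt g v := by ext; simp [gradAt]
    rw [this]; exact M.add_mem hf hg
  | smul h f hf ih =>
    have : gradAt (h • f) v = MvPolynomial.aeval v h • gradAt f v := by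
      ext
      simp [gradAt, (MvPolynomial.mem_zeroLocus_iff.1 hv) f hf]
    rw [this]; exact M.smul_mem _ ih

/-- On a smooth scheme of codimension at least `2`, the Jacobian matrix has rank at least `2`
at every point. -/
theorem not_forall_gradAt_mem_span_singleton {S : Set (MvPolynomial (Fin (N + 1)) k)}
    (hsm : IsSmooth K (Ideal.span S)) (hht : 2 ≤ (Ideal.span S).height) {v : Fin (N + 1) → K}
    (hv0 : v ≠ 0) (hv : v ∈ MvPolynomial.zeroLocus K (Ideal.span S)) (w : Fin (N + 1) → K)
    (hw : ∀ f ∈ S, gradAt f v ∈ Submodule.span K {w}) : False := by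
  have hle : Submodule.span K {u | ∃ f ∈ Ideal.span S, u = gradAt f v} ≤ Submodule.span K {w} := by
    rw [Submodule.span_le]
    rintro _ ⟨f, hf, rfl⟩
    exact gradAt_mem_of_mem_span hv hw hf
  have h1 : Module.finrank K (Submodule.span K {w}) ≤ 1 := by
    simpa using finrank_span_le_card (R := K) ({w} : Set (Fin (N + 1) → K))
  replace h1 := (Submodule.finrank_mono hle).trans h1
  rw [← hsm v hv0 hv] at hht
  have : 2 ≤ 1 := le_trans (by exact_mod_cast hht) h1
  omega

theorem mem_zeroSet_of_mem_zeroLocus {d : ℕ} {S : Set (MvPolynomial (Fin (N + 1)) k)}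
    (hS : ∀ f ∈ S, IsDiagonalForm d f) {v : Fin (N + 1) → K} (hv0 : v ≠ 0)
    (hv : v ∈ MvPolynomial.zeroLocus K (Ideal.span S)) :
    Projectivization.mk K v hv0 ∈ zeroSet K (Ideal.span S) := by
  intro w hw hwv
  obtain ⟨t, rfl⟩ := (Projectivization.mk_eq_mk_iff K w v hw hv0).1 hwv
  rw [MvPolynomial.zeroLocus_span] at hv ⊢
  intro f hf
  have hvf := hv f hf
  obtain ⟨a, rfl⟩ := hS f hf
  rw [aeval_diagonal] at hvf ⊢
  simp only [Units.smul_def, Pi.smul_apply, smul_eq_mul, mul_pow, mul_left_comm _ (_ ^ d),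
    ← Finset.mul_sum, hvf, mul_zero]

theorem mulVec_mem_zeroLocus {d : ℕ} {S : Set (MvPolynomial (Fin (N + 1)) k)}
    (hS : ∀ f ∈ S, IsDiagonalForm d f) {g : GL (Fin (N + 1)) K}
    (hg : Matrix.ProjGenLinGroup.mk g ∈ linearAut (zeroSet K (Ideal.span S)))
    {v : Fin (N + 1) → K} (hv : v ∈ MvPolynomial.zeroLocus K (Ideal.span S)) :
    g.val.mulVec v ∈ MvPolynomial.zeroLocus K (Ideal.span S) := by
  rcases eq_or_ne v 0 with rfl | hv0
  · rwa [Matrix.mulVec_zero]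
  · have h1 := Set.smul_mem_smul_set (a := Matrix.ProjGenLinGroup.mk g)
      (mem_zeroSet_of_mem_zeroLocus hS hv0 hv)
    rw [MulAction.mem_stabilizer_iff.1 hg] at h1
    exact h1 _ _ rfl

theorem natCast_ne_zero_of_isSmooth {d : ℕ} {S : Set (MvPolynomial (Fin (N + 1)) k)}
    (hS : ∀ f ∈ S, IsDiagonalForm d f) (hsm : IsSmooth K (Ideal.span S))
    (hht : 2 ≤ (Ideal.span S).height) {v : Fin (N + 1) → K} (hv0 : v ≠ 0)
    (hv : v ∈ MvPolynomial.zeroLocus K (Ideal.span S)) : (d : K) ≠ 0 := by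
  intro hd
  refine not_forall_gradAt_mem_span_singleton hsm hht hv0 hv 0 fun f hf => ?_
  obtain ⟨a, rfl⟩ := hS f hf
  rw [gradAt_diagonal]
  have : (fun j => algebraMap k K (a j) * (d * v j ^ (d - 1))) = 0 := by ext; simp [hd]
  rw [this]
  exact Submodule.zero_mem _

/-- The space of coefficient vectors of the diagonal forms of degree `d` over `K` that vanish
on `C`. -/
def diagonalRelations (d : ℕ) (C : Set (Fin (N + 1) → K)) : Submodule K (Fin (N + 1) → K) where
  carrier := {a | ∀ v ∈ C, ∑ j, a j * v j ^ d = 0}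
  zero_mem' v _ := by simp
  add_mem' {a b} ha hb v hv := by
    simp only [Pi.add_apply, add_mul, Finset.sum_add_distrib, ha v hv, hb v hv, add_zero]
  smul_mem' t a ha v hv := by
    simp only [Pi.smul_apply, smul_eq_mul, mul_assoc, ← Finset.mul_sum, ha v hv, mul_zero]

/-- If diagonal forms over `k` cut out a cone, then so do all the diagonal forms over `K` that
vanish on it. -/
theorem mem_zeroLocus_iff_diagonalRelations {d : ℕ} {S : Set (MvPolynomial (Fin (N + 1)) k)}
    (hS : ∀ f ∈ S, IsDiagonalForm d f) (v : Fin (N + 1) → K) :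
    v ∈ MvPolynomial.zeroLocus K (Ideal.span S) ↔
      ∀ a ∈ diagonalRelations d (MvPolynomial.zeroLocus K (Ideal.span S)),
        ∑ j, a j * v j ^ d = 0 := by
  refine ⟨fun hv a ha => ha v hv, fun h => ?_⟩
  rw [MvPolynomial.zeroLocus_span]
  intro f hf
  obtain ⟨a, rfl⟩ := hS f hf
  rw [aeval_diagonal]
  refine h (fun j => algebraMap k K (a j)) fun w hw => ?_
  rw [← aeval_diagonal]
  exact hw _ (Ideal.subset_span hf)

/-- Two coordinates that are proportional on all relations would give a point supported on these two
coordinates, at which the Jacobian matrix has rank at most `1`. -/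
theorem exists_relation_separating [IsAlgClosed K] {d : ℕ} (hd : 2 ≤ d)
    {S : Set (MvPolynomial (Fin (N + 1)) k)} (hS : ∀ f ∈ S, IsDiagonalForm d f)
    (hsm : IsSmooth K (Ideal.span S)) (hht : 2 ≤ (Ideal.span S).height)
    {i j : Fin (N + 1)} (hij : i ≠ j) :
    ∃ a ∈ diagonalRelations d (MvPolynomial.zeroLocus K (Ideal.span S)), a i ≠ 0 ∧ a j = 0 := by
  set D := diagonalRelations d (MvPolynomial.zeroLocus K (Ideal.span S)) with hD
  by_contra! hcon
  obtain ⟨c, hc⟩ : ∃ c : K, ∀ a ∈ D, a i = c * a j := by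
    by_cases h : ∃ b ∈ D, b j ≠ 0
    · obtain ⟨b, hb, hbj⟩ := h
      refine ⟨b i / b j, fun a ha => ?_⟩
      by_contra hne
      refine hcon (a - (a j / b j) • b) (D.sub_mem ha (D.smul_mem _ hb)) ?_ ?_
      · contrapose! hne
        simp only [Pi.sub_apply, Pi.smul_apply, smul_eq_mul, sub_eq_zero] at hne
        rw [hne]; ring
      · simp [hbj]
    · push Not at h
      refine ⟨0, fun a ha => ?_⟩
      by_contra hne
      exact hcon a ha (by simpa using hne) (h a ha)
  -- The vector `e_i - c e_j` is orthogonal to `D`; `v` is a coordinatewise `d`-th root of it.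
  obtain ⟨t, ht⟩ := IsAlgClosed.exists_pow_nat_eq (-c) (show 0 < d by omega)
  set v : Fin (N + 1) → K := Pi.single i 1 + Pi.single j t with hv
  have hvi : v i = 1 := by simp [hv, hij]
  have hvj : v j = t := by simp [hv, hij.symm]
  have hvl : ∀ l, l ≠ i → l ≠ j → v l = 0 := fun l hi hj => by simp [hv, hi, hj]
  have hv0 : v ≠ 0 := fun h => one_ne_zero (hvi.symm.trans (congrFun h i))
  have hvC : v ∈ MvPolynomial.zeroLocus K (Ideal.span S) := by
    rw [mem_zeroLocus_iff_diagonalRelations hS]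
    intro a ha
    rw [Fintype.sum_eq_add i j hij fun l hl => by
        rw [hvl l hl.1 hl.2, zero_pow (by omega), mul_zero],
      hvi, hvj, ht, hc a ha]
    ring
  -- Since `a i = c * a j`, every gradient at `v` is a multiple of `c e_i + t ^ (d - 1) e_j`.
  refine not_forall_gradAt_mem_span_singleton hsm hht hv0 hvC
    (Pi.single i c + Pi.single j (t ^ (d - 1))) fun f hf => ?_
  obtain ⟨a, rfl⟩ := hS f hf
  have haD : (fun l => algebraMap k K (a l)) ∈ D := fun w hw => by
    rw [← aeval_diagonal]
    exact hw _ (Ideal.subset_span hf)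
  rw [gradAt_diagonal, Submodule.mem_span_singleton]
  refine ⟨algebraMap k K (a j) * d, ?_⟩
  ext l
  simp only [Pi.smul_apply, Pi.add_apply, smul_eq_mul]
  by_cases hi : l = i
  · subst hi
    simp only [Pi.single_eq_same, Pi.single_eq_of_ne hij, add_zero, hvi, one_pow, mul_one]
    rw [hc _ haD]
    ring
  by_cases hj : l = j
  · subst hj
    simp only [Pi.single_eq_same, Pi.single_eq_of_ne hi, zero_add, hvj, mul_assoc]
  · simp only [Pi.single_eq_of_ne hi, Pi.single_eq_of_ne hj, hvl l hi hj]
    rw [zero_pow (by omega)]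
    ring

/-- The common form of both parts: a smooth intersection of diagonal hypersurfaces of degree
`d ≥ 2`, of codimension at least `2` and contained in no coordinate hyperplane, has only scalar
permutations as linear automorphisms. -/
theorem isScalarPermutation_of_mem_linearAut [IsAlgClosed K] {d : ℕ} (hd : 2 ≤ d)
    {S : Set (MvPolynomial (Fin (N + 1)) k)} (hS : ∀ f ∈ S, IsDiagonalForm d f)
    (hsm : IsSmooth K (Ideal.span S)) (hht : 2 ≤ (Ideal.span S).height)
    (hne : ∀ j, ∃ v ∈ MvPolynomial.zeroLocus K (Ideal.span S), v j ≠ 0)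
    {φ : Matrix.ProjGenLinGroup (Fin (N + 1)) K}
    (hφ : φ ∈ linearAut (zeroSet K (Ideal.span S))) : IsScalarPermutation φ := by
  induction φ using Matrix.ProjGenLinGroup.induction_on with | mk g => ?_
  have hdK : (d : K) ≠ 0 := by
    obtain ⟨v, hv, hv0⟩ := hne 0
    exact natCast_ne_zero_of_isSmooth hS hsm hht (fun h => hv0 (congrFun h 0)) hv
  have hpt : ∃ v ∈ MvPolynomial.zeroLocus K (Ideal.span S), ∀ j, v j ≠ 0 := by
    set D := diagonalRelations d (MvPolynomial.zeroLocus K (Ideal.span S))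
    -- `V` consists of the vectors of `d`-th powers of coordinates of points of the cone.
    let V : Submodule K (Fin (N + 1) → K) :=
      ⨅ a ∈ D, LinearMap.ker (dotProductBilin K K a)
    have hV : ∀ y, y ∈ V ↔ ∀ a ∈ D, ∑ j, a j * y j = 0 := fun y => by
      simp only [V, Submodule.mem_iInf, LinearMap.mem_ker]
      rfl
    obtain ⟨y, hy, hy0⟩ := exists_forall_ne_zero (V := V) fun j => by
      obtain ⟨v, hv, hvj⟩ := hne j
      exact ⟨fun l => v l ^ d, (hV _).2 fun a ha => ha v hv, pow_ne_zero d hvj⟩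
    choose v hv using fun l => IsAlgClosed.exists_pow_nat_eq (y l) (show 0 < d by omega)
    refine ⟨v, (mem_zeroLocus_iff_diagonalRelations hS v).2 fun a ha => ?_, fun l hl => hy0 l ?_⟩
    · simp only [hv]
      exact (hV y).1 hy a ha
    · rw [← hv l, hl, zero_pow (by omega)]
  exact ⟨g, rfl, monomial_of_cone_stable hd hdK (mem_zeroLocus_iff_diagonalRelations hS)
    (fun i j hij => exists_relation_separating hd hS hsm hht hij) hpt
    fun v hv => mulVec_mem_zeroLocus hS hφ hv⟩

end Jacobian

/-! ### Nondegenerate sets and Büchi surfaces -/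

section Buchi

variable {k K : Type*} [Field k] [Field K] [Algebra k K]

theorem exists_apply_ne_zero_of_isNondegenerate {N : ℕ} {X : Set (PSpace K N)}
    (hX : IsProjectiveOver k X) (hnd : IsNondegenerate k X) (j : Fin (N + 1)) :
    ∃ v ∈ MvPolynomial.zeroLocus K (definingIdeal k X), v j ≠ 0 := by
  by_contra! h
  refine MvPolynomial.X_ne_zero j (hnd (MvPolynomial.X j) ?_ (MvPolynomial.isHomogeneous_X k j))
  rintro v ⟨hv, hvX⟩
  rw [← hX] at hvX
  simpa using h v (hvX v hv rfl)

/-- The coefficients of `x_{i+2}^2 - 2 x_{i+1}^2 + x_i^2 - 2 x_0^2` as a diagonal form. For `i = 0`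
the last two terms fall on the same coordinate. -/
def buchiCoeff (k : Type*) [Field k] {n i : ℕ} (hi : i + 2 ≤ n) : Fin (n + 1) → k :=
  Pi.single ⟨i + 2, by omega⟩ 1 - 2 * Pi.single ⟨i + 1, by omega⟩ 1 + Pi.single ⟨i, by omega⟩ 1
    - 2 * Pi.single 0 1

/-- The `i`-th equation of the Büchi surface, written as a diagonal form. -/
noncomputable def buchiEquation (k : Type*) [Field k] {n i : ℕ} (hi : i + 2 ≤ n) :
    MvPolynomial (Fin (n + 1)) k :=
  ∑ j, MvPolynomial.C (buchiCoeff k hi j) * MvPolynomial.X j ^ 2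

theorem buchiEquation_eq {n i : ℕ} (hi : i + 2 ≤ n) :
    buchiEquation k hi = MvPolynomial.X ⟨i + 2, by omega⟩ ^ 2
      - 2 * MvPolynomial.X ⟨i + 1, by omega⟩ ^ 2
      + MvPolynomial.X ⟨i, by omega⟩ ^ 2 - 2 * MvPolynomial.X 0 ^ 2 := by
  have hC2 : (MvPolynomial.C 2 : MvPolynomial (Fin (n + 1)) k) = 2 := map_ofNat _ 2
  have hC : ∀ l : Fin (n + 1), ∑ j, MvPolynomial.C ((Pi.single l 1 : Fin (n + 1) → k) j) *
      MvPolynomial.X j ^ 2 = (MvPolynomial.X l ^ 2 : MvPolynomial (Fin (n + 1)) k) := fun l => by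
    rw [Fintype.sum_eq_single l fun j hj => by simp [hj]]
    simp
  simp only [buchiEquation, buchiCoeff, Pi.add_apply, Pi.sub_apply, Pi.mul_apply, Pi.ofNat_apply,
    map_add, map_sub, map_mul, hC2, add_mul, sub_mul, mul_assoc, Finset.sum_add_distrib,
    Finset.sum_sub_distrib, ← Finset.mul_sum, hC]

theorem buchiIdeal_eq_span (n : ℕ) :
    buchiIdeal k n =
      Ideal.span {f | ∃ (i : ℕ) (_ : 1 ≤ i) (hi : i + 2 ≤ n), f = buchiEquation k hi} := by
  simp only [buchiIdeal, buchiEquation_eq]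

theorem mem_zeroLocus_buchiIdeal {n : ℕ} {v : Fin (n + 1) → K} :
    v ∈ MvPolynomial.zeroLocus K (buchiIdeal k n) ↔
      ∀ i, 1 ≤ i → ∀ hi : i + 2 ≤ n, v ⟨i + 2, by omega⟩ ^ 2 - 2 * v ⟨i + 1, by omega⟩ ^ 2
        + v ⟨i, by omega⟩ ^ 2 - 2 * v 0 ^ 2 = 0 := by
  rw [buchiIdeal, MvPolynomial.zeroLocus_span]
  constructor
  · intro h i hi1 hi
    simpa using h _ ⟨i, hi1, hi, rfl⟩
  · rintro h _ ⟨i, hi1, hi, rfl⟩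
    simpa using h i hi1 hi

/-- The squares of an arithmetic progression with difference `s` have second differences
`2 * s ^ 2`. -/
theorem arithmeticProgression_mem_zeroLocus (n : ℕ) (s t : K) :
    (fun j : Fin (n + 1) => if j = 0 then s else s * (j : ℕ) + t) ∈
      MvPolynomial.zeroLocus K (buchiIdeal k n) := by
  rw [mem_zeroLocus_buchiIdeal]
  intro i hi1 hi
  have h : (⟨i, by omega⟩ : Fin (n + 1)) ≠ 0 := fun h => by
    have := congrArg Fin.val h
    simp at this; omega
  simp [h, Fin.ext_iff]
  ring

/-- At the point `(0 : 1 : ⋯ : 1)`, the gradients of the first two equations are independent unless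
the characteristic is `2`. In characteristic `2` all gradients vanish there, and smoothness would
force the ideal to be zero. -/
theorem two_le_height_buchiIdeal {n : ℕ} (hn : 4 ≤ n) (hsm : IsSmooth K (buchiIdeal k n)) :
    2 ≤ (buchiIdeal k n).height := by
  set v := (fun j : Fin (n + 1) => if j = 0 then (0 : K) else 0 * (j : ℕ) + 1) with hv
  have hvC := arithmeticProgression_mem_zeroLocus (k := k) n (0 : K) 1
  rw [← hv] at hvC
  have hv0 : v ≠ 0 := fun h => by
    have := congrFun h ⟨1, by omega⟩
    simp [hv] at this
  have hsmv := hsm v hv0 hvC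
  have hgrad : ∀ {i : ℕ} (hi : i + 2 ≤ n), gradAt (buchiEquation k hi) v =
      fun j => algebraMap k K (buchiCoeff k hi j) * (2 * v j) := fun hi => by
    rw [buchiEquation, gradAt_diagonal]
    simp
  have hmem : ∀ {i : ℕ} (_ : 1 ≤ i) (hi : i + 2 ≤ n), buchiEquation k hi ∈ buchiIdeal k n :=
    fun hi1 hi => by
      rw [buchiIdeal_eq_span]
      exact Ideal.subset_span ⟨_, hi1, hi, rfl⟩
  by_cases h2 : (2 : K) = 0
  · exfalso
    have hle : Submodule.span K {w | ∃ f ∈ buchiIdeal k n, w = gradAt f v} = ⊥ := by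
      rw [eq_bot_iff, Submodule.span_le]
      rintro _ ⟨f, hf, rfl⟩
      rw [buchiIdeal_eq_span] at hvC hf
      refine gradAt_mem_of_mem_span hvC ?_ hf
      rintro _ ⟨i, hi1, hi, rfl⟩
      rw [hgrad, Submodule.mem_bot]
      ext
      simp [h2]
    rw [hle, finrank_bot, Nat.cast_zero, eq_comm, Ideal.height_eq_zero_iff_eq_bot] at hsmv
    have h0 : buchiEquation k (show 1 + 2 ≤ n by omega) = 0 := by
      simpa [hsmv] using hmem le_rfl (show 1 + 2 ≤ n by omega)
    -- The first equation is nonzero also in characteristic `2`: it takes the value `1` at `e_3`.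
    have := congrArg (MvPolynomial.eval (Pi.single ⟨3, by omega⟩ 1)) h0
    simp [buchiEquation_eq, Fin.ext_iff] at this
  · have c11 : buchiCoeff k (show 1 + 2 ≤ n by omega) ⟨1, by omega⟩ = 1 := by
      simp [buchiCoeff, Fin.ext_iff]
    have c14 : buchiCoeff k (show 1 + 2 ≤ n by omega) ⟨4, by omega⟩ = 0 := by
      simp [buchiCoeff, Fin.ext_iff]
    have c21 : buchiCoeff k (show 2 + 2 ≤ n by omega) ⟨1, by omega⟩ = 0 := by
      simp [buchiCoeff, Fin.ext_iff]
    have c24 : buchiCoeff k (show 2 + 2 ≤ n by omega) ⟨4, by omega⟩ = 1 := by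
      simp [buchiCoeff, Fin.ext_iff]
    have v1 : v ⟨1, by omega⟩ = 1 := by simp [hv]
    have v4 : v ⟨4, by omega⟩ = 1 := by simp [hv]
    -- The first and the fourth coordinates of the two gradients form the matrix `2 • 1`.
    have hli : LinearIndependent K ![gradAt (buchiEquation k (show 1 + 2 ≤ n by omega)) v,
        gradAt (buchiEquation k (show 2 + 2 ≤ n by omega)) v] := by
      rw [LinearIndependent.pair_iff]
      intro s t hst
      rw [hgrad, hgrad] at hst
      have e1 := congrFun hst ⟨1, by omega⟩
      have e4 := congrFun hst ⟨4, by omega⟩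
      simp only [Pi.add_apply, Pi.smul_apply, Pi.zero_apply, smul_eq_mul, c11, c21, v1] at e1
      simp only [Pi.add_apply, Pi.smul_apply, Pi.zero_apply, smul_eq_mul, c14, c24, v4] at e4
      exact ⟨by simpa [h2] using e1, by simpa [h2] using e4⟩
    have h3 := finrank_span_eq_card hli
    rw [← hsmv]
    have h4 : Submodule.span K (Set.range ![gradAt (buchiEquation k (show 1 + 2 ≤ n by omega)) v,
        gradAt (buchiEquation k (show 2 + 2 ≤ n by omega)) v]) ≤
        Submodule.span K {w | ∃ f ∈ buchiIdeal k n, w = gradAt f v} := by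
      refine Submodule.span_mono ?_
      rintro _ ⟨l, rfl⟩
      fin_cases l
      · exact ⟨_, hmem le_rfl _, rfl⟩
      · exact ⟨_, hmem one_le_two _, rfl⟩
    have h5 := Submodule.finrank_mono h4
    rw [h3, Fintype.card_fin] at h5
    exact_mod_cast h5

end Buchi

end ProjVar

theorem mainTheorem5 {k K : Type*} [Field k] [Field K] [Algebra k K] [IsAlgClosed K] :
    (∀ (N d : ℕ) (X : Set (ProjVar.PSpace K N)), 2 ≤ d →
      ProjVar.IsProjectiveOver k X →
      ProjVar.IsNondegenerate k X →
      ProjVar.IsSmooth K (ProjVar.definingIdeal k X) →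
      2 ≤ ProjVar.codim k X →
      ProjVar.IsDiagonalCompleteIntersection d (ProjVar.definingIdeal k X) →
      ∀ φ ∈ ProjVar.linearAut X, ProjVar.IsScalarPermutation φ) ∧
    (∀ n : ℕ, 4 ≤ n → ProjVar.IsSmooth K (ProjVar.buchiIdeal k n) →
      ∀ φ ∈ ProjVar.linearAut (ProjVar.buchiSurface k K n), ProjVar.IsScalarPermutation φ) := by
  constructor
  · rintro N d X hd hX hnd hsm hht ⟨c, f, hf, hI, -⟩ φ hφ
    have hne := ProjVar.exists_apply_ne_zero_of_isNondegenerate hX hnd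
    rw [← hX] at hφ
    rw [ProjVar.codim] at hht
    rw [hI] at hφ hsm hht hne
    refine ProjVar.isScalarPermutation_of_mem_linearAut hd ?_ hsm hht hne hφ
    rintro _ ⟨i, rfl⟩
    exact hf i
  · intro n hn hsm φ hφ
    have hht := ProjVar.two_le_height_buchiIdeal hn hsm
    have hne : ∀ j : Fin (n + 1), ∃ v ∈ MvPolynomial.zeroLocus K (ProjVar.buchiIdeal k n),
        v j ≠ 0 := by
      intro j
      by_cases hj : j = 0
      · exact ⟨_, ProjVar.arithmeticProgression_mem_zeroLocus n 1 0, by simp [hj]⟩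
      · exact ⟨_, ProjVar.arithmeticProgression_mem_zeroLocus n 0 1, by simp [hj]⟩
    rw [ProjVar.buchiSurface] at hφ
    rw [ProjVar.buchiIdeal_eq_span] at hφ hsm hht hne
    refine ProjVar.isScalarPermutation_of_mem_linearAut le_rfl ?_ hsm hht hne hφ
    rintro _ ⟨i, hi1, hi, rfl⟩
    exact ⟨_, rfl⟩
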